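/- Let $d\ge 0$ and let $W^d=\{(x_1,\dots,x_d)\in\mathbb{Z}^d : x_1>\cdots>x_d>0\}$. For $\lambda,\mu\in W^d$ let $b_n(\lambda;\mu)$ be the number of lattice walks of length $n$ from $\lambda$ to $\mu$ that stay in $W^d$ and whose steps are positive or negative unit coordinate vectors $\pm e_i$. For $s\in\mathbb{Z}$ let $$I_s(2t)=[z^s]\exp\bigl(t(z+z^{-1})\bigr)=\sum_{n\ge 0,\ n+s\ge 0}\frac{t^{2n+s}}{n!\,(n+s)!},$$ $$J_s(2t)=[z^s]\,(1+z)\exp\bigl(t(z+z^{-1})\bigr)=I_s(2t)+I_{s-1}(2t).$$ Then the exponential generating function of the number of such walks that start at $\bar{\mathbf 0}=(d,d-1,\dots,1)$ and end anywhere is, as a formal power series in $t$, $$\sum_{n\ge 0}\ \sum_{\mu\in W^d} b_n(\bar{\mathbf 0};\mu)\,\frac{t^n}{n!}=\det\bigl(J_{i-j}(2t)\bigr)_{1\le i,j\le d}.$$ Equivalently, let $\tilde f_n(d)$ be the number of oscillating tableaux of length $n$, of any shape and of height at most $d$, i.e. of sequences $\varnothing=\mu^0,\mu^1,\dots,\mu^n$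 of partitions with at most $d$ parts in which the diagram of each $\mu^k$, $1\le k\le n$, is obtained from that of $\mu^{k-1}$ by adding or removing one square. Then $$\sum_{n\ge 0}\tilde f_n(d)\,\frac{t^n}{n!}=\det\bigl(J_{i-j}(2t)\bigr)_{1\le i,j\le d}.$$ -/

import Mathlib

noncomputable section

/-- The integral points of the Weyl chamber: `W^d = {x ∈ ℤ^d : x₁ > ⋯ > x_d > 0}`. -/
def weylChamber (d : ℕ) : Set (Fin d → ℤ) :=
  {x | StrictAnti x ∧ ∀ i, 0 < x i}

/-- The point `(d, d - 1, …, 1)` of `W^d` (the index `i : Fin d` counts from `0`). -/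
def weylStart (d : ℕ) : Fin d → ℤ :=
  fun i => (d : ℤ) - (i : ℤ)

/-- The Weyl oscillating lattice walks of length `n` from `a` to `b`: sequences
`w₀ = a, w₁, …, w_n = b` of points of `W^d` whose consecutive differences are
`e_i` or `-e_i`, where `e_i` is a unit coordinate vector. -/
def weylWalks (d n : ℕ) (a b : Fin d → ℤ) : Set (Fin (n + 1) → Fin d → ℤ) :=
  {w | w 0 = a ∧ w (Fin.last n) = b ∧ (∀ k, w k ∈ weylChamber d) ∧
    ∀ k : Fin n, ∃ i : Fin d,
      w k.succ = w k.castSucc + Pi.single i 1 ∨ w k.succ = w k.castSucc - Pi.single i 1}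

/-- `b_n(a; b)`, the number of Weyl oscillating lattice walks of length `n` from `a` to `b`. -/
def weylWalkCount (d n : ℕ) (a b : Fin d → ℤ) : ℕ :=
  (weylWalks d n a b).ncard

/-- `ν` is obtained from `μ` by adding one square. -/
def AddsSquare (μ ν : YoungDiagram) : Prop :=
  ∃ c : ℕ × ℕ, c ∉ μ.cells ∧ ν.cells = insert c μ.cells

/-- The oscillating tableaux of length `n`, of height at most `d`, and of any shape: sequences
`∅ = μ⁰, μ¹, …, μⁿ` of Young diagrams with at most `d` rows, each obtained from the
preceding one by adding or removing one square. -/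
def oscillatingTableaux (d n : ℕ) : Set (Fin (n + 1) → YoungDiagram) :=
  {μ | μ 0 = ⊥ ∧ (∀ k, (μ k).colLen 0 ≤ d) ∧
    ∀ k : Fin n, AddsSquare (μ k.castSucc) (μ k.succ) ∨ AddsSquare (μ k.succ) (μ k.castSucc)}

/-- The exponential generating function `∑_{n ≥ 0} u_n tⁿ / n!`. -/
def expGenFun (u : ℕ → ℕ) : PowerSeries ℚ :=
  PowerSeries.mk fun n => (u n : ℚ) / (n.factorial : ℚ)

/-- `exp (t (z + z⁻¹))`, as a power series in `t` over the Laurent polynomials in `z`. -/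
def expKernel : PowerSeries (LaurentPolynomial ℚ) :=
  PowerSeries.rescale (LaurentPolynomial.T 1 + LaurentPolynomial.T (-1))
    (PowerSeries.exp (LaurentPolynomial ℚ))

/-- `[z^s] F`, for `F` a power series in `t` over the Laurent polynomials in `z`. -/
def zCoeff (s : ℤ) (F : PowerSeries (LaurentPolynomial ℚ)) : PowerSeries ℚ :=
  PowerSeries.mk fun n => (PowerSeries.coeff n F).coeff s

/-- `I_s(2t) = ∑_{n ≥ 0, n + s ≥ 0} t^(2n+s) / (n! (n+s)!)`, where `I_s` is the hyperbolic
(modified) Bessel function of the first kind of integer order `s`. In the coefficient of `t^m`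
only the indices `n ≤ m` can contribute. -/
def besselI (s : ℤ) : PowerSeries ℚ :=
  PowerSeries.mk fun m => ∑ n ∈ Finset.range (m + 1),
    if 0 ≤ (n : ℤ) + s ∧ (m : ℤ) = 2 * n + s then
      1 / ((n.factorial : ℚ) * (((n : ℤ) + s).toNat.factorial : ℚ))
    else 0

/-- `J_s(2t) = I_s(2t) + I_{s-1}(2t)`. -/
def besselJ (s : ℤ) : PowerSeries ℚ :=
  besselI s + besselI (s - 1)

end


/-
By the reflection principle for the signed permutations, the walks in `W^d` from `a` are counted by
the sum, over the signed permutations of `a` as starting points, of signed counts of unconstrained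
walks. The generating polynomial of the unconstrained walks is a power of `∑ (z_i + z_i⁻¹)`, so the
count is the value at `∏ (z_i^(a_i) - z_i^(-a_i)) * (∑ (z_i + z_i⁻¹))^n` of the linear functional
that takes a monomial to the sign of the permutation sorting its exponents, if these are positive
and distinct, and to `0` otherwise.

For `a = (d, …, 1)`, antisymmetrizing the product yields the Weyl denominator of type `C`. Summing
over all end points is Littlewood's identity for the sum of all Schur functions, in the form that
the functional above takes `∏ (1 - z_i⁻¹) ∏_{i<j} (1 - z_i⁻¹ z_j⁻¹) * g` to the constant term of
`∏ z_i⁻¹ ∏_{i<j} (z_i⁻¹ - z_j⁻¹) * g`; it follows by induction on the number of variables from the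
effect of a shift of all exponents by `1` and an identity of Lagrange interpolation. The type `C`
denominator is a multiple of the product on the left, and what remains is the constant term of
`det (z_i^(j-i-1) (1 + z_i)) * (∑ (z_i + z_i⁻¹))^n`, in which the rows of the determinant are in
separate variables; its exponential generating function is `det (J_{i-j}(2t))`, as
`J_{1-s} = J_s`.
-/
section PairProducts

open Finset

variable {ι R : Type*} [LinearOrder ι]

/-- The product of `g i j` over the pairs `i < j` of elements of `s`. -/
def pairProd [CommMonoid R] (s : Finset ι) (g : ι → ι → R) : R :=
  ∏ i ∈ s, ∏ j ∈ s, if i < j then g i j else 1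

/-- The product of the differences `v i - v j` over the pairs `i < j` of elements of `s`: up to
the order of its factors, the Vandermonde determinant of `v` on `s`. -/
def diffProd [CommRing R] (s : Finset ι) (v : ι → R) : R :=
  pairProd s fun i j => v i - v j

/-- The sign `(-1) ^ #{j ∈ s | k < j}` of the cycle that moves `k` to the end of `s`. -/
def eraseSign (s : Finset ι) (k : ι) : ℤ :=
  (-1) ^ #{j ∈ s | k < j}

@[simp]
lemma pairProd_empty [CommMonoid R] (g : ι → ι → R) : pairProd ∅ g = 1 :=
  rfl

lemma pairProd_mul [CommMonoid R] (s : Finset ι) (g h : ι → ι → R) :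
    pairProd s (fun i j => g i j * h i j) = pairProd s g * pairProd s h := by
  simp only [pairProd, ← prod_mul_distrib, ite_mul_ite, one_mul]

lemma pairProd_erase [CommMonoid R] {s : Finset ι} {k : ι} (hk : k ∈ s) (g : ι → ι → R) :
    pairProd s g = pairProd (s.erase k) g * ∏ j ∈ s.erase k, if k < j then g k j else g j k := by
  have split_row (i : ι) : (∏ j ∈ s, if i < j then g i j else 1) =
      (if i < k then g i k else 1) * ∏ j ∈ s.erase k, if i < j then g i j else 1 :=
    (mul_prod_erase s _ hk).symm
  have split_pair {j : ι} (hj : j ∈ s.erase k) : (if k < j then g k j else g j k) =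
      (if k < j then g k j else 1) * (if j < k then g j k else 1) := by
    rcases (ne_of_mem_erase hj).lt_or_gt with h | h <;> simp [h, h.not_gt]
  rw [prod_congr rfl fun j => split_pair, prod_mul_distrib, pairProd, ← mul_prod_erase s _ hk]
  simp only [split_row, prod_mul_distrib, lt_irrefl, if_false, one_mul, pairProd]
  rw [mul_left_comm, mul_comm, mul_left_comm, mul_assoc]

lemma map_diffProd {S F : Type*} [CommRing R] [CommRing S] [FunLike F R S] [RingHomClass F R S]
    (f : F) (s : Finset ι) (v : ι → R) : f (diffProd s v) = diffProd s fun i => f (v i) := by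
  simp only [diffProd, pairProd, map_prod, apply_ite f, map_sub, map_one]

lemma diffProd_congr [CommRing R] {s : Finset ι} {v w : ι → R}
    (h : ∀ i ∈ s, ∀ j ∈ s, v i - v j = w i - w j) : diffProd s v = diffProd s w :=
  prod_congr rfl fun i hi => prod_congr rfl fun j hj => by simp only [h i hi j hj]

lemma diffProd_eq_eraseSign_mul [CommRing R] {s : Finset ι} {k : ι} (hk : k ∈ s) (v : ι → R) :
    diffProd s v =
      eraseSign s k * (diffProd (s.erase k) v * ∏ j ∈ s.erase k, (v j - v k)) := by
  have sign_eq : (eraseSign s k : R) = ∏ j ∈ s.erase k, if k < j then -1 else 1 := by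
    rw [prod_erase s (by simp), prod_ite, prod_const, prod_const_one, mul_one, eraseSign,
      Int.cast_pow, Int.cast_neg, Int.cast_one]
  rw [diffProd, pairProd_erase hk, sign_eq, mul_left_comm, ← prod_mul_distrib]
  refine congrArg _ (prod_congr rfl fun j _ => ?_)
  split_ifs <;> ring

lemma diffProd_univ_eq_det [CommRing R] {d : ℕ} (v : Fin d → R) :
    diffProd univ v = (Matrix.of fun i j : Fin d => v i ^ (d - 1 - (j : ℕ))).det := by
  have proj : (Matrix.of fun i j : Fin d => v i ^ (d - 1 - (j : ℕ))) =
      Matrix.projVandermonde (1 : Fin d → R) v := by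
    ext i j
    rw [Matrix.projVandermonde_apply, Pi.one_apply, one_pow, one_mul, Matrix.of_apply,
      Fin.val_rev, Nat.sub_sub, Nat.add_comm]
  rw [proj, Matrix.det_projVandermonde, diffProd, pairProd]
  refine prod_congr rfl fun i _ => ?_
  rw [← prod_filter, filter_lt_eq_Ioi (a := i)]
  simp only [Pi.one_apply, one_mul]

lemma diffProd_univ_comp_perm [CommRing R] {d : ℕ} (v : Fin d → R) (σ : Equiv.Perm (Fin d)) :
    diffProd univ (v ∘ σ) = (Equiv.Perm.sign σ : ℤ) * diffProd univ v := by
  rw [diffProd_univ_eq_det, diffProd_univ_eq_det v, ← Matrix.det_permute]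
  rfl

end PairProducts

section Interpolation

open Finset Polynomial

variable {ι R : Type*} [CommRing R] {s : Finset ι} {x : ι → R}

lemma degree_prod_le_card {κ : Type*} {t : Finset κ} {f : κ → R[X]}
    (hf : ∀ i ∈ t, (f i).natDegree ≤ 1) : (∏ i ∈ t, f i).degree ≤ #t := by
  refine degree_le_of_natDegree_le ((natDegree_prod_le t f).trans ?_)
  simpa using sum_le_card_nsmul t _ 1 hf

variable [IsDomain R]

lemma exists_X_add_one_mul_eq_prod_sub_prod (s : Finset ι) (x : ι → R) :
    ∃ Q : R[X], Q.degree < #s ∧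
      (X + 1) * Q = ∏ j ∈ s, (1 - C (x j) * X) - ∏ j ∈ s, (C (x j) - X) := by
  have root : (∏ j ∈ s, (1 - C (x j) * X) - ∏ j ∈ s, (C (x j) - X)).IsRoot (-1) := by
    simp [eval_prod, add_comm]
  obtain ⟨Q, hQ⟩ := dvd_iff_isRoot.2 root
  rw [map_neg, sub_neg_eq_add, map_one] at hQ
  refine ⟨Q, ?_, hQ.symm⟩
  rcases eq_or_ne Q 0 with rfl | hQ0
  · simp
  · calc Q.degree < (Q * X).degree := degree_lt_degree_mul_X hQ0
      _ = ((X + 1) * Q).degree := by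
        rw [degree_mul, degree_mul, add_comm, degree_X, ← C_1, degree_X_add_C]
      _ ≤ #s := by
        rw [← hQ]
        exact (degree_sub_le _ _).trans <| max_le
          (degree_prod_le_card fun j _ => by compute_degree!)
          (degree_prod_le_card fun j _ => by compute_degree!)

variable [LinearOrder ι]

/-- Lagrange interpolation of `Q` at the nodes `x k`, cleared of denominators. -/
lemma sum_eraseSign_mul_eval_smul_prod (hx : Set.InjOn x s) {Q : R[X]} (hQ : Q.degree < #s) :
    ∑ k ∈ s, (eraseSign s k * Q.eval (x k) * diffProd (s.erase k) x) •
      ∏ j ∈ s.erase k, (C (x j) - X) = diffProd s x • Q := by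
  have degree_lt {k : ι} (hk : k ∈ s) :
      (∏ j ∈ s.erase k, (C (x j) - X)).degree < (#s : WithBot ℕ) :=
    (degree_prod_le_card fun j _ => by compute_degree!).trans_lt
      (Nat.cast_lt.2 (card_erase_lt_of_mem hk))
  refine eq_of_degrees_lt_of_eval_index_eq s hx ?_ ?_ fun m hm => ?_
  · exact mem_degreeLT.1 (Submodule.sum_mem _ fun k hk =>
      Submodule.smul_mem _ _ (mem_degreeLT.2 (degree_lt hk)))
  · exact (degree_smul_le _ _).trans_lt hQ
  · rw [eval_finsetSum, sum_eq_single_of_mem m hm fun k _ hkm => ?_]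
    · simp only [eval_smul, eval_prod, eval_sub, eval_C, eval_X, smul_eq_mul]
      rw [diffProd_eq_eraseSign_mul hm]
      ring
    · rw [eval_smul, eval_prod, prod_eq_zero (mem_erase.2 ⟨hkm.symm, hm⟩) (by simp), smul_zero]

lemma sum_eraseSign_mul_prod_one_sub_mul (hx : Set.InjOn x s) (hx1 : ∀ i ∈ s, x i ≠ -1) :
    ∑ k ∈ s, (eraseSign s k : R) * ((1 - x k) * ∏ j ∈ s.erase k, (1 - x j * x k)) *
      (diffProd (s.erase k) x * ∏ j ∈ s.erase k, x j) = (1 - ∏ j ∈ s, x j) * diffProd s x := by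
  obtain ⟨Q, hQ, hQ_mul⟩ := exists_X_add_one_mul_eq_prod_sub_prod s x
  have eval_Q {k : ι} (hk : k ∈ s) :
      Q.eval (x k) = (1 - x k) * ∏ j ∈ s.erase k, (1 - x j * x k) := by
    have h := congrArg (eval (x k)) hQ_mul
    rw [← mul_prod_erase s _ hk, ← mul_prod_erase s (fun j => C (x j) - X) hk] at h
    simp only [eval_mul, eval_add, eval_sub, eval_X, eval_C, eval_one, eval_prod, sub_self,
      zero_mul, sub_zero] at h
    refine mul_left_cancel₀ (fun h0 => hx1 k hk (eq_neg_of_add_eq_zero_left h0)) (h.trans ?_)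
    ring
  have eval_Q_zero : Q.eval 0 = 1 - ∏ j ∈ s, x j := by
    simpa [eval_prod] using congrArg (eval 0) hQ_mul
  have h := congrArg (eval 0) (sum_eraseSign_mul_eval_smul_prod hx hQ)
  simp only [eval_finsetSum, eval_smul, smul_eq_mul, eval_prod, eval_sub, eval_C, eval_X,
    sub_zero, eval_Q_zero] at h
  rw [mul_comm (1 - _), ← h]
  exact sum_congr rfl fun k hk => by rw [eval_Q hk, ← mul_assoc]

end Interpolation

section SortSign

open Finset

variable {ι : Type*} [LinearOrder ι] {s : Finset ι} {a : ι → ℤ} {k : ι}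

/-- The sign of the permutation sorting `a` decreasingly, for `a` positive with distinct values
on `s` and zero off `s`; zero for all other `a`. -/
noncomputable def sortSign (s : Finset ι) (a : ι → ℤ) : ℤ :=
  open Classical in
  if (∀ i ∈ s, 0 < a i) ∧ ∀ i ∉ s, a i = 0 then (diffProd s a).sign else 0

lemma sortSign_of_pos (hpos : ∀ i ∈ s, 0 < a i) (hzero : ∀ i ∉ s, a i = 0) :
    sortSign s a = (diffProd s a).sign :=
  if_pos ⟨hpos, hzero⟩

lemma sortSign_of_nonpos (hk : k ∈ s) (ha : a k ≤ 0) : sortSign s a = 0 :=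
  if_neg fun h => (h.1 k hk).not_ge ha

lemma sortSign_of_ne_zero (hk : k ∉ s) (ha : a k ≠ 0) : sortSign s a = 0 :=
  if_neg fun h => ha (h.2 k hk)

lemma sortSign_empty (a : ι → ℤ) [Decidable (a = 0)] : sortSign ∅ a = if a = 0 then 1 else 0 := by
  split_ifs with h
  · rw [sortSign_of_pos (by simp) fun i _ => congrFun h i, diffProd, pairProd_empty, Int.sign_one]
  · obtain ⟨i, hi⟩ := Function.ne_iff.1 h
    exact sortSign_of_ne_zero (notMem_empty i) hi

lemma sortSign_add_indicator (hpos : ∀ i ∈ s, 0 ≤ a i) (hzero : ∀ i ∉ s, a i = 0) :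
    sortSign s (a + (s : Set ι).indicator 1) = (diffProd s a).sign := by
  rw [sortSign_of_pos (fun i hi => by simpa [hi] using hpos i hi)
    (fun i hi => by simpa [hi] using hzero i hi)]
  exact congrArg _ (diffProd_congr fun i hi j hj => by simp [hi, hj])

lemma sign_diffProd_eq_eraseSign_mul_sortSign (hpos : ∀ i ∈ s, 0 ≤ a i) (hzero : ∀ i ∉ s, a i = 0)
    (hk : k ∈ s) (hak : a k = 0) :
    (diffProd s a).sign = eraseSign s k * sortSign (s.erase k) a := by
  have sign_eraseSign : (eraseSign s k).sign = eraseSign s k := by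
    rcases neg_one_pow_eq_or ℤ #{j ∈ s | k < j} with h | h <;> simp [eraseSign, h]
  rw [diffProd_eq_eraseSign_mul hk, Int.cast_id, Int.sign_mul, sign_eraseSign]
  by_cases h : ∀ j ∈ s.erase k, 0 < a j
  · have prod_pos : 0 < ∏ j ∈ s.erase k, (a j - a k) :=
      Finset.prod_pos fun j hj => by simpa [hak] using h j hj
    have zero_off (i : ι) (hi : i ∉ s.erase k) : a i = 0 := by
      by_cases hik : i = k
      · rw [hik, hak]
      · exact hzero i fun his => hi (mem_erase.2 ⟨hik, his⟩)
    rw [sortSign_of_pos h zero_off, Int.sign_mul, Int.sign_eq_one_of_pos prod_pos, mul_one]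
  · push Not at h
    obtain ⟨j, hj, haj⟩ := h
    have haj0 : a j = 0 := haj.antisymm (hpos j (mem_of_mem_erase hj))
    rw [sortSign_of_nonpos hj haj, prod_eq_zero hj (by rw [haj0, hak, sub_zero]), mul_zero,
      Int.sign_zero]

lemma sortSign_add_indicator_sub (s : Finset ι) (a : ι → ℤ) :
    sortSign s (a + (s : Set ι).indicator 1) - sortSign s a =
      ∑ k ∈ s, eraseSign s k * sortSign (s.erase k) a := by
  by_cases hzero : ∀ i ∉ s, a i = 0
  · by_cases hpos : ∀ i ∈ s, 0 ≤ a i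
    · rw [sortSign_add_indicator hpos hzero]
      by_cases hk : ∃ k ∈ s, a k = 0
      · obtain ⟨k, hk, hak⟩ := hk
        rw [sortSign_of_nonpos hk hak.le, sub_zero, sum_eq_single_of_mem k hk fun j _ hjk => by
          rw [sortSign_of_nonpos (mem_erase.2 ⟨hjk.symm, hk⟩) hak.le, mul_zero]]
        exact sign_diffProd_eq_eraseSign_mul_sortSign hpos hzero hk hak
      · push Not at hk
        rw [sortSign_of_pos (fun i hi => (hpos i hi).lt_of_ne' (hk i hi)) hzero, sub_self,
          sum_eq_zero fun k hks => by
            rw [sortSign_of_ne_zero (notMem_erase k s) (hk k hks), mul_zero]]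
    · push Not at hpos
      obtain ⟨i, hi, hai⟩ := hpos
      rw [sortSign_of_nonpos hi (by simp [hi]; omega), sortSign_of_nonpos hi hai.le, sub_zero,
        sum_eq_zero fun k _ => ?_]
      rcases eq_or_ne i k with rfl | hik
      · rw [sortSign_of_ne_zero (notMem_erase i s) hai.ne, mul_zero]
      · rw [sortSign_of_nonpos (mem_erase.2 ⟨hik, hi⟩) hai.le, mul_zero]
  · push Not at hzero
    obtain ⟨i, hi, hai⟩ := hzero
    rw [sortSign_of_ne_zero hi (by simpa [hi] using hai), sortSign_of_ne_zero hi hai, sub_zero,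
      sum_eq_zero fun k _ => by
        rw [sortSign_of_ne_zero (fun h => hi (mem_of_mem_erase h)) hai, mul_zero]]

lemma sortSign_univ_comp_perm {d : ℕ} (a : Fin d → ℤ) (σ : Equiv.Perm (Fin d)) :
    sortSign univ (a ∘ σ) = Equiv.Perm.sign σ * sortSign univ a := by
  have sign_sign : (Equiv.Perm.sign σ : ℤ).sign = Equiv.Perm.sign σ := by
    rcases Int.units_eq_one_or (Equiv.Perm.sign σ) with h | h <;> simp [h]
  by_cases h : ∀ i, 0 < a i
  · rw [sortSign_of_pos (a := a ∘ σ) (fun i _ => h (σ i)) (fun i hi => absurd (mem_univ i) hi),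
      sortSign_of_pos (fun i _ => h i) (fun i hi => absurd (mem_univ i) hi),
      diffProd_univ_comp_perm, Int.cast_id, Int.sign_mul, sign_sign]
  · push Not at h
    obtain ⟨i, hi⟩ := h
    rw [sortSign_of_nonpos (mem_univ i) hi,
      sortSign_of_nonpos (k := σ.symm i) (mem_univ _) (by simpa using hi), mul_zero]

end SortSign

section LittlewoodDenom

open Finset

variable {ι R : Type*} [LinearOrder ι] [CommRing R]

/-- The product `∏ (1 - x i) ∏_{i < j} (1 - x i x j)`, whose inverse is the sum of all Schur
functions in the variables `x i` by Littlewood's identity. -/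
def littlewoodDenom (s : Finset ι) (x : ι → R) : R :=
  (∏ i ∈ s, (1 - x i)) * pairProd s fun i j => 1 - x i * x j

lemma littlewoodDenom_erase {s : Finset ι} {k : ι} (hk : k ∈ s) (x : ι → R) :
    littlewoodDenom s x =
      littlewoodDenom (s.erase k) x * ((1 - x k) * ∏ j ∈ s.erase k, (1 - x j * x k)) := by
  simp only [littlewoodDenom, pairProd_erase hk, mul_comm (x k), ite_self,
    ← mul_prod_erase s (fun i => 1 - x i) hk]
  ring

end LittlewoodDenom

section WeylDenominator

open Finset Polynomial

lemma chebyshevS_natCast_add_two (R : Type*) [CommRing R] (n : ℕ) :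
    Chebyshev.S R (n + 2 : ℕ) = X * Chebyshev.S R (n + 1 : ℕ) - Chebyshev.S R n := by
  exact_mod_cast Chebyshev.S_add_two R n

lemma degree_chebyshevS (R : Type*) [CommRing R] [Nontrivial R] (n : ℕ) :
    (Chebyshev.S R n).degree = n := by
  induction n using Nat.twoStepInduction with
  | zero => simp
  | one => simp
  | more n ih0 ih1 =>
    have degree_X_mul : (X * Chebyshev.S R (n + 1 : ℕ)).degree = ((n + 2 : ℕ) : WithBot ℕ) := by
      rw [mul_comm, degree_mul_X, ih1]
      norm_cast
    rw [chebyshevS_natCast_add_two, degree_sub_eq_left_of_degree_lt, degree_X_mul]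
    rw [degree_X_mul, ih0]
    exact_mod_cast (by lia : n < n + 2)

lemma monic_chebyshevS (R : Type*) [CommRing R] [Nontrivial R] (n : ℕ) :
    (Chebyshev.S R n).Monic := by
  induction n using Nat.twoStepInduction with
  | zero => simp
  | one => simp [monic_X]
  | more n _ ih =>
    rw [chebyshevS_natCast_add_two]
    refine (monic_X.mul ih).sub_of_left ?_
    rw [mul_comm, degree_mul_X, degree_chebyshevS, degree_chebyshevS]
    exact_mod_cast (by lia : n < n + 1 + 1)

lemma det_eval_chebyshevS {R : Type*} [CommRing R] {d : ℕ} (w : Fin d → R) :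
    (Matrix.of fun i j : Fin d => (Chebyshev.S R (d - 1 - j : ℕ)).eval (w i)).det =
      diffProd univ w := by
  nontriviality R
  have h := Matrix.det_eval_matrixOfPolynomials_eq_det_vandermonde (w ∘ Fin.rev)
    (fun j : Fin d => Chebyshev.S R (j : ℕ))
    (fun j => natDegree_eq_of_degree_eq_some (degree_chebyshevS R j))
    (fun j => monic_chebyshevS R j)
  rw [← Matrix.det_submatrix_equiv_self Fin.revPerm,
    ← Matrix.det_submatrix_equiv_self Fin.revPerm (Matrix.of _)] at h
  rw [diffProd_univ_eq_det]
  convert h.symm using 2 <;> ext i j <;> simp [Nat.sub_sub, add_comm]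

lemma pow_sub_pow_eq_mul_eval_chebyshevS {R : Type*} [CommRing R] {x z : R} (h : x * z = 1)
    (n : ℕ) :
    z ^ (n + 1) - x ^ (n + 1) = (z - x) * (Chebyshev.S R n).eval (z + x) := by
  induction n using Nat.twoStepInduction with
  | zero => simp
  | one =>
    rw [Nat.cast_one, Chebyshev.S_one, eval_X]
    ring
  | more n ih0 ih1 =>
    rw [chebyshevS_natCast_add_two, eval_sub, eval_mul, eval_X, mul_sub, mul_left_comm, ← ih0,
      ← ih1]
    linear_combination (x ^ (n + 1) - z ^ (n + 1)) * h

/-- The Weyl denominator formula of type `C`. -/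
theorem det_pow_sub_pow_eq_littlewoodDenom_mul {R : Type*} [CommRing R] {d : ℕ} {x z : Fin d → R}
    (h : ∀ i, x i * z i = 1) :
    (Matrix.of fun i j : Fin d => z i ^ (d - (j : ℕ)) - x i ^ (d - (j : ℕ))).det =
      littlewoodDenom univ x * ((∏ i, (1 + z i)) * diffProd univ z) := by
  have entry : (Matrix.of fun i j : Fin d => z i ^ (d - (j : ℕ)) - x i ^ (d - (j : ℕ))) =
      Matrix.of fun i j : Fin d => (z i - x i) *
        Matrix.of (fun i j : Fin d => (Chebyshev.S R (d - 1 - j : ℕ)).eval (z i + x i)) i j := by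
    ext i j
    rw [Matrix.of_apply, Matrix.of_apply, Matrix.of_apply,
      ← pow_sub_pow_eq_mul_eval_chebyshevS (h i), show d - 1 - (j : ℕ) + 1 = d - j by lia]
  have sub_eq (i : Fin d) : z i - x i = (1 - x i) * (1 + z i) := by
    linear_combination h i
  have add_sub_add_eq (i j : Fin d) :
      z i + x i - (z j + x j) = (1 - x i * x j) * (z i - z j) := by
    linear_combination x j * h i - x i * h j
  rw [entry, Matrix.det_mul_column, det_eval_chebyshevS]
  simp only [littlewoodDenom, diffProd, sub_eq, add_sub_add_eq, prod_mul_distrib, pairProd_mul]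
  ring

end WeylDenominator

/-- Laurent polynomials over `R` in the variables `z i`, `i : ι`. -/
abbrev MvLaurentPolynomial (ι R : Type*) [CommRing R] : Type _ :=
  AddMonoidAlgebra R (ι → ℤ)

namespace MvLaurentPolynomial

open Finset AddMonoidAlgebra

variable {ι R : Type*} [CommRing R]

/-- The linear functional with the value `q a` on the monomial with exponent vector `a`. -/
noncomputable def functional (q : (ι → ℤ) → R) : MvLaurentPolynomial ι R →ₗ[R] R :=
  Finsupp.linearCombination R q ∘ₗ (coeffLinearEquiv R).toLinearMap

@[simp]
lemma functional_single (q : (ι → ℤ) → R) (a : ι → ℤ) (r : R) :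
    functional q (single a r) = r * q a := by
  simp [functional]

section ZPow

variable [DecidableEq ι]

/-- The power `z i ^ n` of a variable. -/
noncomputable def zPow (i : ι) (n : ℤ) : MvLaurentPolynomial ι R :=
  single (Pi.single i n) 1

@[simp]
lemma zPow_zero (i : ι) : (zPow i 0 : MvLaurentPolynomial ι R) = 1 := by
  rw [zPow, Pi.single_zero, one_def]

lemma zPow_add (i : ι) (m n : ℤ) :
    (zPow i (m + n) : MvLaurentPolynomial ι R) = zPow i m * zPow i n := by
  rw [zPow, Pi.single_add, zPow, zPow, single_mul_single, one_mul]

lemma zPow_pow (i : ι) (m : ℤ) (n : ℕ) :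
    (zPow i m ^ n : MvLaurentPolynomial ι R) = zPow i (n * m) := by
  rw [zPow, single_pow, one_pow, ← Pi.single_smul, nsmul_eq_mul, zPow]

lemma prod_zPow_neg_one (s : Finset ι) :
    (∏ i ∈ s, zPow i (-1) : MvLaurentPolynomial ι R) =
      single (-(s : Set ι).indicator 1) 1 := by
  simp only [zPow, prod_single, prod_const_one]
  congr 1
  ext j
  by_cases hj : j ∈ s <;> simp [hj, Pi.single_apply]

lemma zPow_injective [Nontrivial R] {n : ℤ} (hn : n ≠ 0) :
    Function.Injective fun i : ι => (zPow i n : MvLaurentPolynomial ι R) := fun i j h => by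
  by_contra hij
  have := congrFun (single_left_injective one_ne_zero h) i
  simp [hij, hn] at this

lemma zPow_ne_neg_one [Nontrivial R] (i : ι) {n : ℤ} (hn : n ≠ 0) :
    (zPow i n : MvLaurentPolynomial ι R) ≠ -1 := fun h => by
  have := congrArg (fun p => p.coeff (Pi.single i n)) h
  simp [zPow, one_def, hn] at this

end ZPow

lemma eventually_functional_prod_pow_mul_eq_zero [DecidableEq ι] {q : (ι → ℤ) → R} {s : Finset ι}
    {k : ι} (hk : k ∈ s) (hq : ∀ a, a k < 0 → q a = 0) (g : MvLaurentPolynomial ι R) :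
    ∀ᶠ m : ℕ in Filter.atTop, functional q ((∏ i ∈ s, zPow i (-1)) ^ m * g) = 0 := by
  induction g using AddMonoidAlgebra.induction_linear with
  | zero => simp
  | add f g hf hg =>
    filter_upwards [hf, hg] with m hf hg
    rw [mul_add, map_add, hf, hg, add_zero]
  | single a r =>
    filter_upwards [Filter.eventually_gt_atTop (a k).toNat] with m hm
    rw [prod_zPow_neg_one, single_pow, single_mul_single, functional_single, hq, mul_zero]
    have : a k < m := by omega
    simpa [hk] using this

section Littlewood

variable [LinearOrder ι]

/-- The linear functional with the value `sortSign s a` on the monomial with exponent vector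
`a`. -/
noncomputable def sortFunctional (s : Finset ι) : MvLaurentPolynomial ι R →ₗ[R] R :=
  functional fun a => (sortSign s a : R)

lemma sortFunctional_one_sub_prod_mul (s : Finset ι) (g : MvLaurentPolynomial ι R) :
    sortFunctional (R := R) s ((1 - ∏ i ∈ s, zPow i (-1)) * g) =
      ∑ k ∈ s, eraseSign s k *
        sortFunctional (R := R) (s.erase k) ((∏ i ∈ s, zPow i (-1)) * g) := by
  suffices h : sortFunctional s ∘ₗ LinearMap.mulLeft R (1 - ∏ i ∈ s, zPow i (-1)) =
      ∑ k ∈ s, (eraseSign s k : R) •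
        (sortFunctional (s.erase k) ∘ₗ LinearMap.mulLeft R (∏ i ∈ s, zPow i (-1))) by
    simpa [LinearMap.sum_apply] using LinearMap.congr_fun h g
  ext a
  have h := sortSign_add_indicator_sub s (-(s : Set ι).indicator 1 + a)
  rw [neg_add_cancel_comm] at h
  simp [prod_zPow_neg_one, sub_mul, single_mul_single, sortFunctional,
    ← Int.cast_sub, ← Int.cast_mul, ← Int.cast_sum, h]

variable [Fintype ι]

/-- The constant term of a Laurent polynomial. -/
noncomputable def constTerm : MvLaurentPolynomial ι R →ₗ[R] R :=
  functional fun a => if a = 0 then 1 else 0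

lemma sortFunctional_empty : sortFunctional (∅ : Finset ι) = constTerm (ι := ι) (R := R) := by
  simp only [sortFunctional, constTerm, sortSign_empty, Int.cast_ite, Int.cast_one, Int.cast_zero]

variable [IsDomain R]

lemma sortFunctional_littlewoodDenom_mul_one_sub_prod_mul {s : Finset ι}
    (ih : ∀ k ∈ s, ∀ g : MvLaurentPolynomial ι R,
      sortFunctional (s.erase k) (littlewoodDenom (s.erase k) (zPow · (-1)) * g) =
        constTerm ((∏ i ∈ s.erase k, zPow i (-1)) * diffProd (s.erase k) (zPow · (-1)) * g))
    (g : MvLaurentPolynomial ι R) :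
    sortFunctional s (littlewoodDenom s (zPow · (-1)) * ((1 - ∏ i ∈ s, zPow i (-1)) * g)) =
      constTerm ((∏ i ∈ s, zPow i (-1)) * diffProd s (zPow · (-1)) *
        ((1 - ∏ i ∈ s, zPow i (-1)) * g)) := by
  set x : ι → MvLaurentPolynomial ι R := (zPow · (-1))
  set X := ∏ i ∈ s, x i
  have x_injective : Function.Injective x := zPow_injective (by decide)
  have x_ne_neg_one (i : ι) : x i ≠ -1 := zPow_ne_neg_one i (by decide)
  have summand {k : ι} (hk : k ∈ s) : (eraseSign s k : R) *
      sortFunctional (s.erase k) (X * (littlewoodDenom s x * g)) =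
      constTerm ((eraseSign s k : MvLaurentPolynomial ι R) *
        ((1 - x k) * ∏ j ∈ s.erase k, (1 - x j * x k)) *
        (diffProd (s.erase k) x * ∏ j ∈ s.erase k, x j) * (X * g)) := by
    have regroup : X * (littlewoodDenom s x * g) = littlewoodDenom (s.erase k) x *
        ((1 - x k) * (∏ j ∈ s.erase k, (1 - x j * x k)) * (X * g)) := by
      rw [littlewoodDenom_erase hk]; ring
    rw [regroup, ih k hk, ← zsmul_eq_mul, ← map_zsmul, zsmul_eq_mul]
    exact congrArg constTerm (by ring)
  calc sortFunctional s (littlewoodDenom s x * ((1 - X) * g))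
      = ∑ k ∈ s, (eraseSign s k : R) *
          sortFunctional (s.erase k) (X * (littlewoodDenom s x * g)) := by
        rw [mul_left_comm, sortFunctional_one_sub_prod_mul]
    _ = constTerm ((1 - X) * diffProd s x * (X * g)) := by
        rw [sum_congr rfl fun k => summand, ← map_sum, ← sum_mul,
          sum_eraseSign_mul_prod_one_sub_mul x_injective.injOn fun i _ => x_ne_neg_one i]
    _ = constTerm (X * diffProd s x * ((1 - X) * g)) := congrArg constTerm (by ring)

/-- Littlewood's identity for the sum of all Schur functions, cleared of denominators: the two
sides agree on multiples of `1 - ∏ x i`, and both vanish on multiples of high powers of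
`∏ x i`. -/
theorem sortFunctional_littlewoodDenom_mul (s : Finset ι) (g : MvLaurentPolynomial ι R) :
    sortFunctional s (littlewoodDenom s (zPow · (-1)) * g) =
      constTerm ((∏ i ∈ s, zPow i (-1)) * diffProd s (zPow · (-1)) * g) := by
  induction s using Finset.strongInduction generalizing g with
  | H s ih =>
  rcases s.eq_empty_or_nonempty with rfl | ⟨k, hk⟩
  · simp [littlewoodDenom, diffProd, sortFunctional_empty]
  set x : ι → MvLaurentPolynomial ι R := (zPow · (-1))
  set X := ∏ i ∈ s, x i
  let defect : MvLaurentPolynomial ι R →ₗ[R] R :=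
    sortFunctional s ∘ₗ LinearMap.mulLeft R (littlewoodDenom s x) -
      constTerm ∘ₗ LinearMap.mulLeft R (X * diffProd s x)
  have defect_pow (m : ℕ) : defect (X ^ m * g) = defect g := by
    induction m with
    | zero => rw [pow_zero, one_mul]
    | succ m ihm =>
      have h : defect ((1 - X) * (X ^ m * g)) = 0 := sub_eq_zero.2
        (sortFunctional_littlewoodDenom_mul_one_sub_prod_mul
          (fun k hk => ih _ (erase_ssubset hk)) _)
      rw [sub_mul, one_mul, map_sub, sub_eq_zero, ihm, ← mul_assoc, ← pow_succ'] at h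
      exact h.symm
  have sort_vanishes : ∀ᶠ m in Filter.atTop,
      sortFunctional s (X ^ m * (littlewoodDenom s x * g)) = 0 :=
    eventually_functional_prod_pow_mul_eq_zero hk
      (fun a ha => by rw [sortSign_of_nonpos hk ha.le, Int.cast_zero]) _
  have const_vanishes : ∀ᶠ m in Filter.atTop, constTerm (X ^ m * (X * diffProd s x * g)) = 0 :=
    eventually_functional_prod_pow_mul_eq_zero hk
      (fun a ha => if_neg fun h => by simp [h] at ha) _
  obtain ⟨m, hsort, hconst⟩ := (sort_vanishes.and const_vanishes).exists
  have defect_eq_zero : defect (X ^ m * g) = 0 := by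
    simp only [defect, LinearMap.sub_apply, LinearMap.comp_apply, LinearMap.mulLeft_apply]
    rw [mul_left_comm, mul_left_comm (X * diffProd s x)]
    exact sub_eq_zero.2 (hsort.trans hconst.symm)
  exact sub_eq_zero.1 ((defect_pow m).symm.trans defect_eq_zero)

end Littlewood

end MvLaurentPolynomial

namespace MvLaurentPolynomial

open Finset LaurentPolynomial

variable {ι R : Type*} [CommRing R]

/-- The substitution of `z (σ i)` for `z i`. -/
noncomputable def permVars (σ : Equiv.Perm ι) :
    MvLaurentPolynomial ι R →ₐ[R] MvLaurentPolynomial ι R :=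
  AddMonoidAlgebra.mapDomainAlgHom R R (LinearMap.funLeft ℤ ℤ σ.symm).toAddMonoidHom

lemma permVars_single (σ : Equiv.Perm ι) (a : ι → ℤ) (r : R) :
    permVars σ (AddMonoidAlgebra.single a r) = AddMonoidAlgebra.single (a ∘ σ.symm) r := by
  simp only [permVars, AddMonoidAlgebra.mapDomainAlgHom_apply, AddMonoidAlgebra.mapDomain_single]
  rfl

/-- A Laurent polynomial is symmetric if it is invariant under permutations of the variables. -/
def IsSymmetric (p : MvLaurentPolynomial ι R) : Prop :=
  ∀ σ, permVars σ p = p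

lemma IsSymmetric.mul {p q : MvLaurentPolynomial ι R} (hp : IsSymmetric p)
    (hq : IsSymmetric q) : IsSymmetric (p * q) := fun σ => by
  rw [map_mul, hp, hq]

lemma IsSymmetric.pow {p : MvLaurentPolynomial ι R} (hp : IsSymmetric p) (n : ℕ) :
    IsSymmetric (p ^ n) := fun σ => by
  rw [map_pow, hp]

lemma constTerm_permVars [Fintype ι] (σ : Equiv.Perm ι) (p : MvLaurentPolynomial ι R) :
    constTerm (permVars σ p) = constTerm p := by
  suffices h : constTerm ∘ₗ (permVars (R := R) σ).toLinearMap = constTerm from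
    LinearMap.congr_fun h p
  ext a
  have : a ∘ σ.symm = 0 ↔ a = 0 := σ.symm.surjective.injective_comp_right.eq_iff' rfl
  simp [constTerm, permVars_single, this]

variable [DecidableEq ι]

/-- The substitution of the variable `z i` into a Laurent polynomial in one variable. -/
noncomputable def subst (i : ι) : R[T;T⁻¹] →ₐ[R] MvLaurentPolynomial ι R :=
  AddMonoidAlgebra.mapDomainAlgHom R R (AddMonoidHom.single (fun _ : ι => ℤ) i)

lemma subst_T (i : ι) (n : ℤ) :
    subst i (T n : R[T;T⁻¹]) = zPow i n := by
  simp [subst, T, zPow, -single_eq_C_mul_T]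

lemma subst_eq_sum (i : ι) (u : R[T;T⁻¹]) :
    subst i u = ∑ k ∈ u.coeff.support, u.coeff k • zPow i k := by
  have eq_sum : u = ∑ k ∈ u.coeff.support, u.coeff k • T k := by
    ext n
    simp [Finsupp.finsetSum_apply]
  conv_lhs => rw [eq_sum]
  simp only [map_sum, map_smul, subst_T]

lemma permVars_zPow (σ : Equiv.Perm ι) (i : ι) (n : ℤ) :
    permVars σ (zPow i n : MvLaurentPolynomial ι R) = zPow (σ i) n := by
  rw [zPow, permVars_single, zPow, Pi.single_comp_equiv, Equiv.symm_symm]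

lemma permVars_subst (σ : Equiv.Perm ι) (i : ι) (u : R[T;T⁻¹]) :
    permVars σ (subst i u) = subst (σ i) u := by
  have h : (permVars σ).comp (subst i) = subst (R := R) (σ i) := by
    ext
    simp [subst_T, permVars_zPow]
  exact DFunLike.congr_fun h u

variable [Fintype ι]

lemma isSymmetric_prod_subst (u : R[T;T⁻¹]) : IsSymmetric (∏ i : ι, subst i u) := fun σ => by
  simp only [map_prod, permVars_subst]
  exact Equiv.prod_comp σ fun i => subst i u

lemma isSymmetric_sum_subst (u : R[T;T⁻¹]) : IsSymmetric (∑ i : ι, subst i u) := fun σ => by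
  simp only [map_sum, permVars_subst]
  exact Equiv.sum_comp σ fun i => subst i u

/-- A linear functional is alternating if a permutation of the variables multiplies it by the
sign of the permutation. -/
def IsAlternating (L : MvLaurentPolynomial ι R →ₗ[R] R) : Prop :=
  ∀ (σ : Equiv.Perm ι) (p : MvLaurentPolynomial ι R), L (permVars σ p) = (σ.sign : ℤ) * L p

lemma IsAlternating.map_det_mul {L : MvLaurentPolynomial ι R →ₗ[R] R} (hL : IsAlternating L)
    (u : ι → R[T;T⁻¹]) {f : MvLaurentPolynomial ι R} (hf : IsSymmetric f) :
    L ((Matrix.of fun i j => subst i (u j)).det * f) =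
      (Fintype.card ι).factorial * L ((∏ i, subst i (u i)) * f) := by
  have summand (σ : Equiv.Perm ι) : L (σ.sign • (∏ i, subst (σ i) (u i)) * f) =
      L ((∏ i, subst i (u i)) * f) := by
    have permuted : (∏ i, subst (σ i) (u i)) * f = permVars σ ((∏ i, subst i (u i)) * f) := by
      simp only [map_mul, map_prod, permVars_subst, hf σ]
    rw [smul_mul_assoc, permuted, Units.smul_def, map_zsmul, hL, zsmul_eq_mul, ← mul_assoc,
      ← Int.cast_mul, Int.units_coe_mul_self, Int.cast_one, one_mul]
  simp only [Matrix.det_apply, Matrix.of_apply, sum_mul, map_sum, summand, sum_const, card_univ,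
    Fintype.card_perm, nsmul_eq_mul]

variable {d : ℕ}

lemma isAlternating_sortFunctional_univ :
    IsAlternating (sortFunctional (R := R) (univ : Finset (Fin d))) := fun σ p => by
  suffices h : sortFunctional univ ∘ₗ (permVars (R := R) σ).toLinearMap =
      ((σ.sign : ℤ) : R) • sortFunctional univ from LinearMap.congr_fun h p
  ext a
  simp [sortFunctional, permVars_single, sortSign_univ_comp_perm]

lemma isAlternating_constTerm_comp_mulLeft : IsAlternating (constTerm ∘ₗ LinearMap.mulLeft R
    ((∏ i : Fin d, zPow i (-1)) * diffProd univ (zPow · (-1)))) := fun σ p => by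
  set D : MvLaurentPolynomial (Fin d) R :=
    (∏ i : Fin d, zPow i (-1)) * diffProd univ (zPow · (-1)) with hD
  have permVars_D : permVars σ D = (σ.sign : ℤ) * D := by
    rw [hD, map_mul, map_prod, map_diffProd]
    simp only [permVars_zPow]
    rw [Equiv.prod_comp σ fun i => zPow i (-1), mul_left_comm,
      ← diffProd_univ_comp_perm _ σ]
    rfl
  have D_mul_permVars : D * permVars σ p = permVars σ ((σ.sign : ℤ) • (D * p)) := by
    rw [map_zsmul, map_mul, permVars_D, ← smul_mul_assoc, zsmul_eq_mul, ← mul_assoc,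
      ← Int.cast_mul, Int.units_coe_mul_self, Int.cast_one, one_mul]
  simp only [LinearMap.comp_apply, LinearMap.mulLeft_apply]
  rw [D_mul_permVars, constTerm_permVars, map_zsmul, zsmul_eq_mul]

lemma det_subst_T_sub_T :
    (Matrix.of fun i j : Fin d => subst i (T ((d : ℤ) - j) - T (-((d : ℤ) - j)) : R[T;T⁻¹])).det =
      littlewoodDenom univ (zPow · (-1)) *
        ((∏ i, subst i (1 + T 1)) * diffProd univ (zPow · 1)) := by
  have entry (i j : Fin d) : subst i (T ((d : ℤ) - j) - T (-((d : ℤ) - j)) : R[T;T⁻¹]) =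
      zPow i 1 ^ (d - (j : ℕ)) - zPow i (-1) ^ (d - (j : ℕ)) := by
    rw [map_sub, subst_T, subst_T, zPow_pow, zPow_pow, mul_one, mul_neg_one, Nat.cast_sub j.2.le]
  simp only [entry, map_add, map_one, subst_T]
  refine det_pow_sub_pow_eq_littlewoodDenom_mul fun i => ?_
  rw [← zPow_add, neg_add_cancel, zPow_zero]

lemma diffProd_univ_zPow_one :
    diffProd univ (zPow · 1 : Fin d → MvLaurentPolynomial (Fin d) R) =
      (Matrix.of fun i j : Fin d => subst i (T (d - 1 - (j : ℕ) : ℕ))).det := by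
  simp only [diffProd_univ_eq_det, zPow_pow, mul_one, subst_T]

lemma det_subst_T_mul :
    (Matrix.of fun i j : Fin d => subst i (T ((j : ℤ) - i - 1) * (1 + T 1) : R[T;T⁻¹])).det =
      (∏ i : Fin d, zPow i (-1)) * diffProd univ (zPow · (-1)) *
        ((∏ i : Fin d, subst i (T (d - 1 - (i : ℕ) : ℕ))) * ∏ i, subst i (1 + T 1)) := by
  have entry : (Matrix.of fun i j : Fin d => subst i (T ((j : ℤ) - i - 1) * (1 + T 1))) =
      Matrix.of fun i j : Fin d =>
        (zPow i (-1) * (subst i (T (d - 1 - (i : ℕ) : ℕ)) * subst i (1 + T 1)) :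
          MvLaurentPolynomial (Fin d) R) *
        Matrix.of (fun i j : Fin d => zPow i (-1) ^ (d - 1 - (j : ℕ))) i j := by
    ext1 i j
    simp only [Matrix.of_apply, map_mul, subst_T, zPow_pow]
    rw [← mul_assoc (zPow i (-1)), mul_right_comm, ← zPow_add, ← zPow_add]
    congr 2
    omega
  rw [entry, Matrix.det_mul_column, ← diffProd_univ_eq_det, prod_mul_distrib, prod_mul_distrib]
  ring

theorem sortFunctional_prod_mul_eq_constTerm_det_mul [IsDomain R] [CharZero R]
    {f : MvLaurentPolynomial (Fin d) R} (hf : IsSymmetric f) :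
    sortFunctional univ ((∏ i : Fin d, subst i (T ((d : ℤ) - i) - T (-((d : ℤ) - i)))) * f) =
      constTerm ((Matrix.of fun i j : Fin d =>
        subst i (T ((j : ℤ) - i - 1) * (1 + T 1))).det * f) := by
  have factorial_ne_zero : ((Fintype.card (Fin d)).factorial : R) ≠ 0 :=
    Nat.cast_ne_zero.2 (Nat.factorial_ne_zero _)
  apply mul_left_cancel₀ factorial_ne_zero
  have h := isAlternating_constTerm_comp_mulLeft.map_det_mul
    (fun j : Fin d => T (d - 1 - (j : ℕ) : ℕ))
    ((isSymmetric_prod_subst (1 + T 1 : R[T;T⁻¹])).mul hf)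
  rw [← isAlternating_sortFunctional_univ.map_det_mul
    (fun j : Fin d => T ((d : ℤ) - j) - T (-((d : ℤ) - j))) hf, det_subst_T_sub_T, mul_assoc,
    sortFunctional_littlewoodDenom_mul, diffProd_univ_zPow_one, det_subst_T_mul,
    mul_comm (∏ i, subst i (1 + T 1)), mul_assoc (Matrix.det _)]
  simpa only [LinearMap.comp_apply, LinearMap.mulLeft_apply, mul_assoc] using h

end MvLaurentPolynomial

section Bessel

open Finset LaurentPolynomial

lemma laurent_coeff_T_mul (n s : ℤ) (f : ℚ[T;T⁻¹]) : (T n * f).coeff s = f.coeff (s - n) := by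
  rw [T, AddMonoidAlgebra.coeff_single_mul_apply, one_mul, neg_add_eq_sub]

lemma coeff_expKernel (n : ℕ) :
    PowerSeries.coeff n expKernel = (1 / (n.factorial : ℚ)) • (T 1 + T (-1) : ℚ[T;T⁻¹]) ^ n := by
  rw [expKernel, PowerSeries.coeff_rescale, PowerSeries.coeff_exp, Algebra.smul_def, mul_comm]

lemma T_one_add_T_neg_one_pow (m : ℕ) : (T 1 + T (-1) : ℚ[T;T⁻¹]) ^ m =
    ∑ n ∈ range (m + 1), (m.choose n : ℚ) • T ((m : ℤ) - 2 * n) := by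
  rw [add_comm, add_pow]
  refine sum_congr rfl fun n hn => ?_
  have hnm : n ≤ m := Nat.lt_succ_iff.1 (mem_range.1 hn)
  rw [T_pow, T_pow, ← T_add, Algebra.smul_def, mul_comm, map_natCast]
  congr 2
  push_cast [hnm]
  ring

lemma besselI_eq_zCoeff (s : ℤ) : besselI s = zCoeff s expKernel := by
  ext m
  rw [besselI, zCoeff, PowerSeries.coeff_mk, PowerSeries.coeff_mk, coeff_expKernel,
    T_one_add_T_neg_one_pow, AddMonoidAlgebra.coeff_smul, AddMonoidAlgebra.coeff_sum,
    Finsupp.smul_apply, Finsupp.finsetSum_apply, smul_eq_mul, mul_sum]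
  refine sum_congr rfl fun n hn => ?_
  have hnm : n ≤ m := Nat.lt_succ_iff.1 (mem_range.1 hn)
  rw [AddMonoidAlgebra.coeff_smul, Finsupp.smul_apply, T_apply, smul_eq_mul]
  by_cases h : (m : ℤ) = 2 * n + s
  · have toNat_eq : ((n : ℤ) + s).toNat = m - n := by omega
    have _ : (m.factorial : ℚ) ≠ 0 := by exact_mod_cast m.factorial_ne_zero
    rw [if_pos ⟨by omega, h⟩, if_pos (by omega), toNat_eq, Nat.cast_choose ℚ hnm]
    field_simp
  · rw [if_neg fun h' => h h'.2, if_neg (by omega), mul_zero, mul_zero]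

lemma besselJ_eq_zCoeff (s : ℤ) :
    besselJ s = zCoeff s (PowerSeries.C (1 + T 1) * expKernel) := by
  rw [besselJ, besselI_eq_zCoeff, besselI_eq_zCoeff]
  ext m
  simp only [zCoeff, map_add (PowerSeries.coeff m), PowerSeries.coeff_mk, PowerSeries.coeff_C_mul,
    add_mul, one_mul, AddMonoidAlgebra.coeff_add, Finsupp.add_apply, laurent_coeff_T_mul]

lemma besselI_neg (s : ℤ) : besselI (-s) = besselI s := by
  rw [besselI_eq_zCoeff, besselI_eq_zCoeff]
  ext m
  rw [zCoeff, zCoeff, PowerSeries.coeff_mk, PowerSeries.coeff_mk, ← invert_apply,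
    coeff_expKernel, map_smul, map_pow, map_add, invert_T, invert_T, neg_neg, add_comm]

lemma besselJ_one_sub (s : ℤ) : besselJ (1 - s) = besselJ s := by
  rw [besselJ, besselJ, ← besselI_neg (1 - s), ← besselI_neg (1 - s - 1), add_comm]
  congr 2 <;> ring

lemma zCoeff_zero_C_mul_expKernel (s : ℤ) :
    zCoeff 0 (PowerSeries.C (T (s - 1) * (1 + T 1)) * expKernel) = besselJ s := by
  rw [← besselJ_one_sub, besselJ_eq_zCoeff]
  ext m
  simp only [zCoeff, PowerSeries.coeff_mk, PowerSeries.coeff_C_mul, mul_assoc,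
    laurent_coeff_T_mul, zero_sub, neg_sub]

lemma prod_rescale_exp {ι A : Type*} [CommRing A] [Algebra ℚ A] (s : Finset ι) (w : ι → A) :
    ∏ i ∈ s, PowerSeries.rescale (w i) (PowerSeries.exp A) =
      PowerSeries.rescale (∑ i ∈ s, w i) (PowerSeries.exp A) := by
  classical
  induction s using Finset.induction_on with
  | empty => simp
  | insert k s hk ih => rw [prod_insert hk, sum_insert hk, ih, PowerSeries.exp_mul_exp_eq_exp_add]

end Bessel

namespace MvLaurentPolynomial

open Finset LaurentPolynomial

variable {ι R : Type*} [DecidableEq ι] [CommRing R]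

lemma map_subst_C_mul_expKernel (i : ι) (u : ℚ[T;T⁻¹]) :
    PowerSeries.map (subst i).toRingHom (PowerSeries.C u * expKernel) =
      PowerSeries.C (subst i u) * PowerSeries.rescale (subst i (T 1 + T (-1)))
        (PowerSeries.exp (MvLaurentPolynomial ι ℚ)) := by
  ext1 m
  rw [PowerSeries.coeff_map, PowerSeries.coeff_C_mul, PowerSeries.coeff_C_mul, coeff_expKernel,
    PowerSeries.coeff_rescale, PowerSeries.coeff_exp, AlgHom.toRingHom_eq_coe, RingHom.coe_coe,
    map_mul, map_smul, map_pow, Algebra.smul_def, mul_comm (algebraMap _ _ _)]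

variable [Fintype ι]

lemma prod_zPow (a : ι → ℤ) :
    (∏ i, zPow i (a i) : MvLaurentPolynomial ι R) = AddMonoidAlgebra.single a 1 := by
  simp only [zPow, AddMonoidAlgebra.prod_single, prod_const_one, univ_sum_single]

lemma constTerm_prod_subst (u : ι → R[T;T⁻¹]) :
    constTerm (∏ i, subst i (u i)) = ∏ i, (u i).coeff 0 := by
  simp only [subst_eq_sum, prod_univ_sum, prod_smul, prod_zPow, map_sum, map_smul, constTerm,
    functional_single, smul_eq_mul, mul_ite, mul_one, mul_zero]
  rw [sum_ite_eq']
  refine ite_eq_left_iff.2 fun h => ?_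
  rw [Fintype.mem_piFinset, not_forall] at h
  obtain ⟨i, hi⟩ := h
  rw [Pi.zero_apply, Finsupp.notMem_support_iff] at hi
  exact (prod_eq_zero (mem_univ i) hi).symm

lemma coeff_prod_zCoeff_zero (G : ι → PowerSeries ℚ[T;T⁻¹]) (n : ℕ) :
    PowerSeries.coeff n (∏ i, zCoeff 0 (G i)) =
      constTerm (PowerSeries.coeff n (∏ i, PowerSeries.map (subst i).toRingHom (G i))) := by
  rw [PowerSeries.coeff_prod, PowerSeries.coeff_prod, map_sum]
  refine sum_congr rfl fun l _ => ?_
  simp only [PowerSeries.coeff_map, AlgHom.toRingHom_eq_coe, RingHom.coe_coe,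
    constTerm_prod_subst, zCoeff, PowerSeries.coeff_mk]

lemma factorial_mul_coeff_prod_zCoeff_C_mul_expKernel (u : ι → ℚ[T;T⁻¹]) (n : ℕ) :
    n.factorial * PowerSeries.coeff n (∏ i, zCoeff 0 (PowerSeries.C (u i) * expKernel)) =
      constTerm ((∏ i, subst i (u i)) * (∑ i, subst i (T 1 + T (-1))) ^ n) := by
  have factorial_ne_zero : (n.factorial : ℚ) ≠ 0 := by exact_mod_cast n.factorial_ne_zero
  simp only [coeff_prod_zCoeff_zero, map_subst_C_mul_expKernel, prod_mul_distrib,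
    prod_rescale_exp]
  rw [← map_prod, PowerSeries.coeff_C_mul, PowerSeries.coeff_rescale, PowerSeries.coeff_exp,
    mul_comm (_ ^ n), mul_left_comm, ← Algebra.smul_def, map_smul, smul_eq_mul, ← mul_assoc,
    mul_one_div_cancel factorial_ne_zero, one_mul]

theorem factorial_mul_coeff_det_besselJ (d n : ℕ) :
    n.factorial * PowerSeries.coeff n
        (Matrix.of fun i j : Fin d => besselJ ((i : ℤ) - (j : ℤ))).det =
      constTerm ((Matrix.of fun i j : Fin d => subst i (T ((j : ℤ) - i - 1) * (1 + T 1))).det *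
        (∑ i, subst i (T 1 + T (-1))) ^ n) := by
  rw [← Matrix.det_transpose (Matrix.of fun i j : Fin d => subst i _), Matrix.det_apply,
    Matrix.det_apply, map_sum, sum_mul, map_sum, mul_sum]
  refine sum_congr rfl fun σ _ => ?_
  have h := factorial_mul_coeff_prod_zCoeff_C_mul_expKernel
    (fun i : Fin d => T (((σ i : Fin d) : ℤ) - i - 1) * (1 + T 1)) n
  simp only [zCoeff_zero_C_mul_expKernel] at h
  simp only [Matrix.of_apply, Matrix.transpose_apply, Units.smul_def, map_zsmul, smul_mul_assoc,
    mul_smul_comm, h]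

end MvLaurentPolynomial

section ConfinedWalks

variable {P V : Type*} [Add V]

/-- The walks of length `n` that start at `a`, take their steps in the family `step`, and stay
in `C`. -/
def confinedWalks (C : Set V) (step : P → V) (n : ℕ) (a : V) : Set (Fin (n + 1) → V) :=
  {w | w 0 = a ∧ (∀ k, w k ∈ C) ∧ ∀ k : Fin n, ∃ p, w k.succ = w k.castSucc + step p}

variable {C : Set V} {step : P → V} {a : V}

lemma confinedWalks_eq_empty (ha : a ∉ C) (n : ℕ) : confinedWalks C step n a = ∅ :=
  Set.eq_empty_of_forall_notMem fun _ hw => ha (hw.1 ▸ hw.2.1 0)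

lemma confinedWalks_zero (ha : a ∈ C) : confinedWalks C step 0 a = {fun _ => a} := by
  ext w
  simp only [confinedWalks, Set.mem_ofPred_eq, Set.mem_singleton_iff, funext_iff (f := w),
    Nat.reduceAdd, Fin.forall_fin_one, IsEmpty.forall_iff, and_true]
  exact and_iff_left_of_imp fun h => h ▸ ha

lemma cons_mem_confinedWalks {n : ℕ} {x : V} {w : Fin (n + 1) → V} :
    (Fin.cons x w : Fin (n + 2) → V) ∈ confinedWalks C step (n + 1) a ↔
      x = a ∧ a ∈ C ∧ ∃ p, w ∈ confinedWalks C step n (a + step p) := by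
  simp only [confinedWalks, Set.mem_ofPred_eq, Fin.forall_fin_succ (n := n),
    Fin.forall_fin_succ (n := n + 1), Fin.cons_zero, Fin.cons_succ, Fin.castSucc_zero,
    ← Fin.succ_castSucc]
  grind

lemma confinedWalks_succ (ha : a ∈ C) (n : ℕ) : confinedWalks C step (n + 1) a =
    ⋃ p, Fin.cons (α := fun _ => V) a '' confinedWalks C step n (a + step p) := by
  ext w
  rw [← Fin.cons_self_tail w, cons_mem_confinedWalks]
  simp only [Set.mem_iUnion, Set.mem_image, Fin.cons_inj]
  grind

lemma finite_confinedWalks [Finite P] (C : Set V) (step : P → V) (n : ℕ) (a : V) :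
    (confinedWalks C step n a).Finite := by
  induction n generalizing a with
  | zero =>
    by_cases ha : a ∈ C
    · simp [confinedWalks_zero ha]
    · simp [confinedWalks_eq_empty ha]
  | succ n ih =>
    by_cases ha : a ∈ C
    · simpa only [confinedWalks_succ ha] using Set.finite_iUnion fun p => (ih _).image _
    · simp [confinedWalks_eq_empty ha]

variable [IsLeftCancelAdd V] [Fintype P]

lemma ncard_confinedWalks_succ (hstep : Function.Injective step) (ha : a ∈ C) (n : ℕ) :
    (confinedWalks C step (n + 1) a).ncard =
      ∑ p, (confinedWalks C step n (a + step p)).ncard := by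
  have cons_injective := Fin.cons_right_injective (α := fun _ : Fin (n + 2) => V) a
  rw [confinedWalks_succ ha, Set.ncard_iUnion_of_finite
    (fun p => (finite_confinedWalks C step n _).image _), finsum_eq_sum_of_fintype]
  · exact Finset.sum_congr rfl fun p _ => Set.ncard_image_of_injective _ cons_injective
  · intro p q hpq
    rw [Function.onFun, Set.disjoint_image_iff cons_injective, Set.disjoint_left]
    intro w hp hq
    exact hpq (hstep (add_left_cancel (hp.1.symm.trans hq.1)))

/-- The reflection principle: a count that obeys the recursion of the walks in `C` and vanishes
at the points outside `C` that are one step away from `C` counts the walks in `C`. -/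
theorem natCast_ncard_confinedWalks {M : Type*} [AddCommMonoidWithOne M] {N : V → ℕ → M}
    (hstep : Function.Injective step) (zero : ∀ a ∈ C, N a 0 = 1)
    (succ : ∀ a ∈ C, ∀ n, N a (n + 1) = ∑ p, N (a + step p) n)
    (exit : ∀ a ∈ C, ∀ p, a + step p ∉ C → ∀ n, N (a + step p) n = 0) (n : ℕ) (ha : a ∈ C) :
    ((confinedWalks C step n a).ncard : M) = N a n := by
  induction n generalizing a with
  | zero => rw [confinedWalks_zero ha, Set.ncard_singleton, Nat.cast_one, zero a ha]
  | succ n ih =>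
    rw [ncard_confinedWalks_succ hstep ha, Nat.cast_sum, succ a ha]
    refine Finset.sum_congr rfl fun p _ => ?_
    by_cases hp : a + step p ∈ C
    · exact ih hp
    · rw [confinedWalks_eq_empty hp, Set.ncard_empty, Nat.cast_zero, exit a ha p hp]

end ConfinedWalks

section Fibers

open Finset

variable {α β : Type*} {S : Set α} {f : α → β} {t : Set β}

lemma ncard_fiber_ne_zero_iff (hS : S.Finite) (b : β) :
    {w ∈ S | f w = b}.ncard ≠ 0 ↔ b ∈ f '' S := by
  rw [← Nat.pos_iff_ne_zero, Set.ncard_pos (hS.sep _)]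
  rfl

lemma finsum_mem_ncard_fiber (hS : S.Finite) (h : Set.MapsTo f S t) :
    ∑ᶠ b ∈ t, {w ∈ S | f w = b}.ncard = S.ncard := by
  classical
  lift S to Finset α using hS
  have ncard_fiber (b : β) : {w ∈ (S : Set α) | f w = b}.ncard = #{w ∈ S | f w = b} := by
    rw [← Set.ncard_coe_finset, Finset.coe_filter]
    rfl
  rw [finsum_mem_eq_sum_of_inter_support_eq (t := S.image f), Set.ncard_coe_finset,
    Finset.card_eq_sum_card_image f S]
  · exact Finset.sum_congr rfl fun b _ => ncard_fiber b
  · ext b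
    simp only [Set.mem_inter_iff, Function.mem_support, ncard_fiber_ne_zero_iff S.finite_toSet,
      Finset.coe_image]
    exact and_congr_left fun ⟨w, hw, hb⟩ => ⟨fun _ => ⟨w, hw, hb⟩, fun _ => hb ▸ h hw⟩

end Fibers


/-- The steps `e i` and `-e i` of the walks. -/
def unitStep {ι : Type*} [DecidableEq ι] (p : ι × ℤˣ) : ι → ℤ :=
  Pi.single p.1 p.2

lemma unitStep_injective {ι : Type*} [DecidableEq ι] :
    Function.Injective (unitStep (ι := ι)) := by
  rintro ⟨i, u⟩ ⟨j, v⟩ h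
  have apply_eq (k : ι) : (if k = i then (u : ℤ) else 0) = if k = j then (v : ℤ) else 0 := by
    simpa only [unitStep, Pi.single_apply] using congrFun h k
  obtain rfl : i = j := by
    by_contra hij
    exact u.ne_zero (by simpa [hij] using apply_eq i)
  exact congrArg (Prod.mk i) (Units.ext (by simpa using apply_eq i))

namespace MvLaurentPolynomial

open Finset LaurentPolynomial

section SignedOrbit

variable {ι R : Type*} [DecidableEq ι] [Fintype ι] [CommRing R]

/-- The signed sum of the monomials whose exponent vectors arise from `a` by changing signs,
written as a product. -/
noncomputable def signedOrbit (R : Type*) [CommRing R] (a : ι → ℤ) : MvLaurentPolynomial ι R :=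
  ∏ i, subst i (T (a i) - T (-a i))

lemma signedOrbit_eq_sum (a : ι → ℤ) : signedOrbit R a =
    ∑ ε : ι → ℤˣ, AddMonoidAlgebra.single (fun i => ε i * a i) (∏ i, ((ε i : ℤ) : R)) := by
  have factor (i : ι) : subst i (T (a i) - T (-a i) : R[T;T⁻¹]) =
      ∑ u : ℤˣ, AddMonoidAlgebra.single (Pi.single i (u * a i)) ((u : ℤ) : R) := by
    simp [subst_T, zPow, UnitsInt.univ, sub_eq_add_neg]
  simp only [signedOrbit, factor, prod_univ_sum, Fintype.piFinset_univ,
    AddMonoidAlgebra.prod_single, univ_sum_single]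

lemma signedOrbit_eq_zero {a : ι → ℤ} {i : ι} (hi : a i = 0) : signedOrbit R a = 0 :=
  prod_eq_zero (mem_univ i) (by rw [hi, neg_zero, sub_self, map_zero])

lemma permVars_signedOrbit (σ : Equiv.Perm ι) (a : ι → ℤ) :
    permVars σ (signedOrbit R a) = signedOrbit R (a ∘ σ.symm) := by
  simp only [signedOrbit, map_prod, permVars_subst]
  exact Fintype.prod_equiv σ _ _ fun i => by simp

lemma signedOrbit_add_single (a : ι → ℤ) (i : ι) (m : ℤ) :
    signedOrbit R (a + Pi.single i m) = subst i (T (a i + m) - T (-(a i + m))) *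
      ∏ j ∈ univ.erase i, subst j (T (a j) - T (-a j)) := by
  rw [signedOrbit, ← mul_prod_erase univ _ (mem_univ i)]
  congr 1
  · simp
  · exact prod_congr rfl fun j hj => by simp [ne_of_mem_erase hj]

lemma signedOrbit_mul_sum_subst (a : ι → ℤ) :
    signedOrbit R a * ∑ i, subst i (T 1 + T (-1)) = ∑ p, signedOrbit R (a + unitStep p) := by
  rw [mul_sum, Fintype.sum_prod_type]
  refine sum_congr rfl fun i _ => ?_
  have factor : (T (a i) - T (-a i)) * (T 1 + T (-1) : R[T;T⁻¹]) =
      (T (a i + 1) - T (-(a i + 1))) + (T (a i + -1) - T (-(a i + -1))) := by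
    simp only [neg_add, T_add]
    ring_nf
  have split := signedOrbit_add_single (R := R) a i 0
  simp only [Pi.single_zero, add_zero] at split
  rw [split, mul_right_comm, ← map_mul, factor, map_add, add_mul]
  simp [UnitsInt.univ, unitStep, signedOrbit_add_single]

end SignedOrbit

section ReflectedCount

variable {R : Type*} [CommRing R] {d : ℕ} {a : Fin d → ℤ}

/-- The signed number of walks of length `n` with steps `±e i` from the images of `a` under sign
changes to the points with distinct positive coordinates. The sign is that of the sign changes
times that of the permutation sorting the end point. -/
noncomputable def reflectedCount (R : Type*) [CommRing R] (a : Fin d → ℤ) (n : ℕ) : R :=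
  sortFunctional univ (signedOrbit R a * (∑ i, subst i (T 1 + T (-1))) ^ n)

lemma reflectedCount_succ (a : Fin d → ℤ) (n : ℕ) :
    reflectedCount R a (n + 1) = ∑ p, reflectedCount R (a + unitStep p) n := by
  simp only [reflectedCount]
  rw [pow_succ', ← mul_assoc, signedOrbit_mul_sum_subst, sum_mul, map_sum]

lemma reflectedCount_zero (ha : a ∈ weylChamber d) : reflectedCount R a 0 = 1 := by
  have diffProd_pos : 0 < diffProd univ a := by
    rw [diffProd, pairProd]
    refine prod_pos fun i _ => prod_pos fun j _ => ?_
    split_ifs with hij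
    exacts [Int.sub_pos_of_lt (ha.1 hij), Int.one_pos]
  rw [reflectedCount, pow_zero, mul_one, signedOrbit_eq_sum, map_sum, sum_eq_single 1]
  · simp [sortFunctional, sortSign_of_pos (s := univ) (a := a) (fun i _ => ha.2 i),
      Int.sign_eq_one_of_pos diffProd_pos]
  · intro ε _ hε
    obtain ⟨i, hi⟩ := Function.ne_iff.1 hε
    have nonpos : ε i * a i ≤ 0 := by
      rw [(Int.units_eq_one_or (ε i)).resolve_left hi]
      simpa using (ha.2 i).le
    rw [sortFunctional, functional_single, sortSign_of_nonpos (mem_univ i) nonpos, Int.cast_zero,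
      mul_zero]
  · exact fun h => absurd (mem_univ 1) h

lemma reflectedCount_eq_zero_of_eq_zero {i : Fin d} (hi : a i = 0) (n : ℕ) :
    reflectedCount R a n = 0 := by
  rw [reflectedCount, signedOrbit_eq_zero hi, zero_mul, map_zero]

lemma reflectedCount_eq_zero_of_eq [IsDomain R] [CharZero R] {i j : Fin d} (hij : i ≠ j)
    (h : a i = a j) (n : ℕ) : reflectedCount R a n = 0 := by
  set f : MvLaurentPolynomial (Fin d) R := (∑ i, subst i (T 1 + T (-1))) ^ n
  have f_symmetric : permVars (Equiv.swap i j) f = f := (isSymmetric_sum_subst _).pow n _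
  have a_comp_swap : a ∘ Equiv.swap i j = a := by
    rw [Equiv.comp_swap_eq_update, h, Function.update_eq_self, ← h, Function.update_eq_self]
  have antisymm := isAlternating_sortFunctional_univ (Equiv.swap i j) (signedOrbit R a * f)
  rw [map_mul, permVars_signedOrbit, f_symmetric, Equiv.symm_swap, a_comp_swap,
    Equiv.Perm.sign_swap hij] at antisymm
  rw [Units.val_neg, Units.val_one, Int.cast_neg, Int.cast_one, neg_one_mul] at antisymm
  exact self_eq_neg.1 antisymm

lemma add_unitStep_mem_weylChamber (ha : a ∈ weylChamber d) {p : Fin d × ℤˣ}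
    (hzero : ∀ i, (a + unitStep p) i ≠ 0)
    (hne : ∀ i j, i ≠ j → (a + unitStep p) i ≠ (a + unitStep p) j) :
    a + unitStep p ∈ weylChamber d := by
  have add_apply (i : Fin d) : (a + unitStep p) i = a i + if i = p.1 then (p.2 : ℤ) else 0 := by
    rw [Pi.add_apply, unitStep, Pi.single_apply]
  have step_eq : (p.2 : ℤ) = 1 ∨ (p.2 : ℤ) = -1 := Int.isUnit_iff.1 p.2.isUnit
  refine ⟨fun i j hij => ?_, fun i => ?_⟩
  · have := ha.1 hij
    have := hne i j hij.ne
    simp only [add_apply] at this ⊢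
    grind
  · have := ha.2 i
    have := hzero i
    simp only [add_apply] at this ⊢
    grind

lemma reflectedCount_add_unitStep_eq_zero [IsDomain R] [CharZero R] (ha : a ∈ weylChamber d)
    {p : Fin d × ℤˣ} (hp : a + unitStep p ∉ weylChamber d) (n : ℕ) :
    reflectedCount R (a + unitStep p) n = 0 := by
  contrapose! hp
  exact add_unitStep_mem_weylChamber ha
    (fun i hi => hp (reflectedCount_eq_zero_of_eq_zero hi n))
    (fun i j hij h => hp (reflectedCount_eq_zero_of_eq hij h n))

end ReflectedCount

end MvLaurentPolynomial

section WeylWalks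

open MvLaurentPolynomial

variable {d : ℕ}

lemma exists_add_or_sub_single_iff (a b : Fin d → ℤ) :
    (∃ i, b = a + Pi.single i 1 ∨ b = a - Pi.single i 1) ↔ ∃ p, b = a + unitStep p := by
  have sub_eq (i : Fin d) : a - Pi.single i 1 = a + Pi.single i (-1) := by
    rw [Pi.single_neg, sub_eq_add_neg]
  simp only [Prod.exists, unitStep, sub_eq]
  refine exists_congr fun i => ⟨?_, ?_⟩
  · rintro (h | h)
    exacts [⟨1, h⟩, ⟨-1, h⟩]
  · rintro ⟨u, h⟩
    rcases Int.units_eq_one_or u with rfl | rfl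
    exacts [Or.inl h, Or.inr h]

lemma weylWalks_eq (n : ℕ) (a b : Fin d → ℤ) : weylWalks d n a b =
    {w ∈ confinedWalks (weylChamber d) unitStep n a | w (Fin.last n) = b} := by
  ext w
  simp only [weylWalks, confinedWalks, Set.mem_ofPred_eq, exists_add_or_sub_single_iff]
  tauto

lemma finite_weylWalks (n : ℕ) (a b : Fin d → ℤ) : (weylWalks d n a b).Finite := by
  rw [weylWalks_eq]
  exact (finite_confinedWalks _ _ n a).sep _

lemma finite_setOf_weylWalkCount_ne_zero (n : ℕ) (a : Fin d → ℤ) :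
    {b ∈ weylChamber d | weylWalkCount d n a b ≠ 0}.Finite := by
  have walks_finite := finite_confinedWalks (weylChamber d) unitStep n a
  simp only [weylWalkCount, weylWalks_eq, ncard_fiber_ne_zero_iff walks_finite]
  exact (walks_finite.image _).subset fun b hb => hb.2

lemma finsum_weylWalkCount (n : ℕ) (a : Fin d → ℤ) :
    ∑ᶠ b ∈ weylChamber d, weylWalkCount d n a b =
      (confinedWalks (weylChamber d) unitStep n a).ncard := by
  simp only [weylWalkCount, weylWalks_eq]
  exact finsum_mem_ncard_fiber (finite_confinedWalks _ _ n a) fun w hw => hw.2.1 _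

lemma weylStart_mem_weylChamber : weylStart d ∈ weylChamber d :=
  ⟨fun i j hij => by simpa [weylStart] using hij, fun i => by simp [weylStart]⟩

lemma ncard_confinedWalks_weylChamber (n : ℕ) {a : Fin d → ℤ} (ha : a ∈ weylChamber d) :
    ((confinedWalks (weylChamber d) unitStep n a).ncard : ℚ) = reflectedCount ℚ a n :=
  natCast_ncard_confinedWalks unitStep_injective (fun _ => reflectedCount_zero)
    (fun a _ => reflectedCount_succ a) (fun _ ha _ => reflectedCount_add_unitStep_eq_zero ha) n ha

theorem expGenFun_ncard_confinedWalks_weylStart (d : ℕ) :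
    expGenFun (fun n => (confinedWalks (weylChamber d) unitStep n (weylStart d)).ncard) =
      Matrix.det (Matrix.of fun i j : Fin d => besselJ ((i : ℤ) - (j : ℤ))) := by
  ext n
  rw [expGenFun, PowerSeries.coeff_mk, ncard_confinedWalks_weylChamber n weylStart_mem_weylChamber,
    div_eq_iff (by positivity), mul_comm, factorial_mul_coeff_det_besselJ]
  exact sortFunctional_prod_mul_eq_constTerm_det_mul ((isSymmetric_sum_subst _).pow n)

end WeylWalks

section OscillatingTableaux

open YoungDiagram

variable {d : ℕ} {μ ν : YoungDiagram}

lemma rowLen_injective : Function.Injective YoungDiagram.rowLen := fun μ ν h => by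
  ext ⟨i, j⟩
  rw [mem_cells, mem_cells, mem_iff_lt_rowLen, mem_iff_lt_rowLen, h]

lemma rowLen_bot : (⊥ : YoungDiagram).rowLen = 0 :=
  funext fun _ => by_contra fun h => notMem_bot _ (mem_iff_lt_rowLen.2 (Nat.pos_of_ne_zero h))

lemma colLen_zero_le_iff : μ.colLen 0 ≤ d ↔ ∀ i, d ≤ i → μ.rowLen i = 0 := by
  simp only [← not_lt, ← mem_iff_lt_colLen, mem_iff_lt_rowLen, Nat.pos_iff_ne_zero]
  refine ⟨fun h i hi => ?_, fun h => not_not.2 (h d (lt_irrefl d))⟩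
  have := μ.rowLen_anti d i (not_lt.1 hi)
  omega

lemma addsSquare_iff_forall_lt_rowLen_iff : AddsSquare μ ν ↔
    ∃ i, ∀ j k, k < ν.rowLen j ↔ (j = i ∧ k = μ.rowLen i) ∨ k < μ.rowLen j := by
  simp only [AddsSquare, Finset.ext_iff, Prod.forall, Prod.exists, Finset.mem_insert, mem_cells,
    mem_iff_lt_rowLen, Prod.mk_inj]
  refine exists_congr fun i => ⟨?_, fun h => ⟨_, lt_irrefl _, h⟩⟩
  rintro ⟨m, hm, h⟩
  obtain rfl : m = μ.rowLen i := by
    have := h i m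
    have := h i (μ.rowLen i)
    omega
  exact h

lemma addsSquare_iff_rowLen_eq : AddsSquare μ ν ↔ ∃ i, ν.rowLen = μ.rowLen + Pi.single i 1 := by
  simp only [addsSquare_iff_forall_lt_rowLen_iff, funext_iff, Pi.add_apply, Pi.single_apply]
  refine exists_congr fun i => forall_congr' fun j => ⟨fun h => eq_of_forall_lt_iff fun k => ?_,
    fun h k => ?_⟩ <;> grind

/-- The vector `(μ₁ + d, μ₂ + d - 1, …, μ_d + 1)`, which identifies the Young diagrams with at most
`d` rows with the points of `W^d`. -/
def shiftedRows (d : ℕ) (μ : YoungDiagram) : Fin d → ℤ :=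
  fun i => μ.rowLen i + weylStart d i

lemma shiftedRows_bot : shiftedRows d ⊥ = weylStart d := by
  ext i
  simp [shiftedRows, rowLen_bot]

lemma shiftedRows_mem_weylChamber (μ : YoungDiagram) : shiftedRows d μ ∈ weylChamber d := by
  refine ⟨fun i j hij => ?_, fun i => ?_⟩
  · exact add_lt_add_of_le_of_lt (by exact_mod_cast μ.rowLen_anti i j hij.le)
      (weylStart_mem_weylChamber.1 hij)
  · exact add_pos_of_nonneg_of_pos (Int.natCast_nonneg _) (weylStart_mem_weylChamber.2 i)

lemma shiftedRows_injOn : Set.InjOn (shiftedRows d) {μ | μ.colLen 0 ≤ d} := by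
  intro μ hμ ν hν h
  refine rowLen_injective (funext fun i => ?_)
  by_cases hi : i < d
  · simpa [shiftedRows] using congrFun h ⟨i, hi⟩
  · rw [colLen_zero_le_iff.1 hμ i (not_lt.1 hi), colLen_zero_le_iff.1 hν i (not_lt.1 hi)]

lemma shiftedRows_eq_add_single_iff (hμ : μ.colLen 0 ≤ d) (hν : ν.colLen 0 ≤ d) (i : Fin d) :
    shiftedRows d ν = shiftedRows d μ + Pi.single i 1 ↔
      ν.rowLen = μ.rowLen + Pi.single (i : ℕ) 1 := by
  rw [colLen_zero_le_iff] at hμ hν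
  simp only [funext_iff, shiftedRows, Pi.add_apply, Pi.single_apply, Fin.ext_iff]
  refine ⟨fun h j => ?_, fun h j => ?_⟩
  · by_cases hj : j < d
    · have := h ⟨j, hj⟩
      grind
    · have hji : j ≠ i := fun hji => hj (hji ▸ i.isLt)
      rw [hμ j (not_lt.1 hj), hν j (not_lt.1 hj), if_neg hji, add_zero]
  · have := h j
    grind

lemma addsSquare_iff_shiftedRows_eq (hμ : μ.colLen 0 ≤ d) (hν : ν.colLen 0 ≤ d) :
    AddsSquare μ ν ↔ ∃ i, shiftedRows d ν = shiftedRows d μ + Pi.single i 1 := by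
  simp only [shiftedRows_eq_add_single_iff hμ hν, addsSquare_iff_rowLen_eq]
  refine ⟨fun ⟨i, h⟩ => ⟨⟨i, lt_of_not_ge fun hi => ?_⟩, h⟩, fun ⟨i, h⟩ => ⟨i, h⟩⟩
  have := congrFun h i
  rw [colLen_zero_le_iff.1 hν i hi] at this
  simp at this

lemma addsSquare_or_addsSquare_iff (hμ : μ.colLen 0 ≤ d) (hν : ν.colLen 0 ≤ d) :
    AddsSquare μ ν ∨ AddsSquare ν μ ↔ ∃ p, shiftedRows d ν = shiftedRows d μ + unitStep p := by
  rw [← exists_add_or_sub_single_iff, addsSquare_iff_shiftedRows_eq hμ hν,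
    addsSquare_iff_shiftedRows_eq hν hμ, exists_or]
  simp only [eq_sub_iff_add_eq, eq_comm (a := shiftedRows d μ)]

lemma antitone_sub_weylStart {a : Fin d → ℤ} (ha : StrictAnti a) : Antitone (a - weylStart d) := by
  cases d with
  | zero => exact Subsingleton.antitone _
  | succ d =>
    refine Fin.antitone_iff_succ_le.2 fun i => ?_
    have := ha i.castSucc_lt_succ
    simp only [weylStart, Pi.sub_apply, Fin.val_succ, Fin.val_castSucc]
    omega

lemma weylStart_le {a : Fin d → ℤ} (ha : a ∈ weylChamber d) : weylStart d ≤ a := by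
  cases d with
  | zero => exact fun i => i.elim0
  | succ d =>
    intro i
    have := antitone_sub_weylStart ha.1 i.le_last
    have := ha.2 (Fin.last d)
    simp only [weylStart, Pi.sub_apply, Fin.val_last] at *
    omega

lemma exists_rowLen_eq {r : Fin d → ℕ} (hr : Antitone r) :
    ∃ μ : YoungDiagram, μ.colLen 0 ≤ d ∧ ∀ i : Fin d, μ.rowLen i = r i := by
  have mem_iff (i j : ℕ) : (i, j) ∈ ofRowLens (List.ofFn r) hr.sortedGE_ofFn ↔
      ∃ h : i < d, j < r ⟨i, h⟩ := by
    simp [mem_ofRowLens]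
  refine ⟨ofRowLens (List.ofFn r) hr.sortedGE_ofFn, ?_, fun i => ?_⟩
  · rw [← not_lt, ← mem_iff_lt_colLen, mem_iff]
    exact fun h => lt_irrefl d h.1
  · refine eq_of_forall_lt_iff fun k => ?_
    rw [← mem_iff_lt_rowLen, mem_iff]
    exact exists_prop_of_true i.isLt

lemma exists_shiftedRows_eq {a : Fin d → ℤ} (ha : a ∈ weylChamber d) :
    ∃ μ : YoungDiagram, μ.colLen 0 ≤ d ∧ shiftedRows d μ = a := by
  obtain ⟨μ, hμ, rowLen_eq⟩ := exists_rowLen_eq fun i j hij =>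
    Int.toNat_le_toNat (antitone_sub_weylStart ha.1 hij)
  refine ⟨μ, hμ, funext fun i => ?_⟩
  rw [shiftedRows, rowLen_eq, Pi.sub_apply, Int.toNat_of_nonneg (sub_nonneg.2 (weylStart_le ha i)),
    sub_add_cancel]

lemma injOn_oscillatingTableaux (n : ℕ) :
    Set.InjOn (fun (μ : Fin (n + 1) → YoungDiagram) k => shiftedRows d (μ k))
      (oscillatingTableaux d n) :=
  fun _ hμ _ hν h => funext fun k => shiftedRows_injOn (hμ.2.1 k) (hν.2.1 k) (congrFun h k)

lemma image_oscillatingTableaux (d n : ℕ) :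
    (fun (μ : Fin (n + 1) → YoungDiagram) k => shiftedRows d (μ k)) '' oscillatingTableaux d n =
      confinedWalks (weylChamber d) unitStep n (weylStart d) := by
  ext w
  constructor
  · rintro ⟨μ, ⟨start, height, steps⟩, rfl⟩
    exact ⟨by simp only [start, shiftedRows_bot], fun k => shiftedRows_mem_weylChamber _,
      fun k => (addsSquare_or_addsSquare_iff (height _) (height _)).1 (steps k)⟩
  · rintro ⟨start, confined, steps⟩
    choose μ height shiftedRows_eq using fun k => exists_shiftedRows_eq (confined k)
    refine ⟨μ, ⟨?_, height, fun k => ?_⟩, funext shiftedRows_eq⟩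
    · exact shiftedRows_injOn (height 0) (colLen_zero_le_iff.2 fun i _ => by simp [rowLen_bot])
        (by rw [shiftedRows_eq, start, shiftedRows_bot])
    · rw [addsSquare_or_addsSquare_iff (height _) (height _), shiftedRows_eq, shiftedRows_eq]
      exact steps k

lemma finite_oscillatingTableaux (d n : ℕ) : (oscillatingTableaux d n).Finite :=
  Set.Finite.of_finite_image (image_oscillatingTableaux d n ▸ finite_confinedWalks _ _ n _)
    (injOn_oscillatingTableaux n)

lemma ncard_oscillatingTableaux (d n : ℕ) : (oscillatingTableaux d n).ncard =
    (confinedWalks (weylChamber d) unitStep n (weylStart d)).ncard := by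
  rw [← image_oscillatingTableaux, (injOn_oscillatingTableaux n).ncard_image]

end OscillatingTableaux

theorem theorem2 (d : ℕ) :
    -- the counts below are counts of finite sets, and the sum over the end points is finite
    (∀ (n : ℕ) (b : Fin d → ℤ), (weylWalks d n (weylStart d) b).Finite) ∧
    (∀ n : ℕ, {b ∈ weylChamber d | weylWalkCount d n (weylStart d) b ≠ 0}.Finite) ∧
    (∀ n : ℕ, (oscillatingTableaux d n).Finite) ∧
    -- the constant-term descriptions of `I_s(2t)` and `J_s(2t)`
    (∀ s : ℤ, besselI s = zCoeff s expKernel) ∧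
    (∀ s : ℤ, besselJ s =
      zCoeff s (PowerSeries.C (1 + LaurentPolynomial.T 1) * expKernel)) ∧
    -- lattice walks starting at `(d, d - 1, …, 1)` and ending anywhere
    expGenFun (fun n => ∑ᶠ b ∈ weylChamber d, weylWalkCount d n (weylStart d) b) =
      Matrix.det (Matrix.of fun i j : Fin d => besselJ ((i : ℤ) - (j : ℤ))) ∧
    -- oscillating tableaux of height at most `d` and of any shape
    expGenFun (fun n => (oscillatingTableaux d n).ncard) =
      Matrix.det (Matrix.of fun i j : Fin d => besselJ ((i : ℤ) - (j : ℤ))) := by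
  refine ⟨fun n b => finite_weylWalks n _ b, fun n => finite_setOf_weylWalkCount_ne_zero n _,
    finite_oscillatingTableaux d, besselI_eq_zCoeff, besselJ_eq_zCoeff, ?_, ?_⟩
  · simp only [finsum_weylWalkCount]
    exact expGenFun_ncard_confinedWalks_weylStart d
  · simp only [ncard_oscillatingTableaux]
    exact expGenFun_ncard_confinedWalks_weylStart d
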